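/- For $f\in L^2(\mathbb{R})$ (complex-valued) let $$\mathcal{G}f(x,\omega)=2^{1/4}\int_{\mathbb{R}} f(t)\,e^{-\pi(t-x)^2}e^{-2\pi i t\omega}\,dt,\quad (x,\omega)\in\mathbb{R}^2,$$ be its Gabor transform and $$\mathcal{B}f(z)=2^{1/4}\int_{\mathbb{R}} f(t)\,e^{2\pi tz-\pi t^2-\frac{\pi}{2}z^2}\,dt,\quad z\in\mathbb{C},$$ its Bargmann transform. Let $\varphi(t)=2^{1/4}e^{-\pi t^2}$ be the normalised Gaussian, and let the Fock space $\mathcal{F}^2(\mathbb{C})$ be the set of entire functions $F$ with $\int_{\mathbb{C}}|F(z)|^2e^{-\pi|z|^2}\,dz<\infty$. For $\Lambda\subset\mathbb{R}^2$ let $\mathfrak{C}(\Lambda)$ be the set of all $f\in L^2(\mathbb{R})$ for which there is $g\in L^2(\mathbb{R})$ such that $|\mathcal{G}f|=|\mathcal{G}g|$ on $\Lambda$ but $f\neq e^{i\alpha}g$ for every $\alpha\in\mathbb{R}$. Let $0<a<1$. Then: 1. If $f\in L^2(\mathbb{R})$ satisfies $|\mathcal{G}f(x,\omega)|^2=|\mathcal{G}\varphi(x,\omega)|^2$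 for all $(x,\omega)\in a\mathbb{Z}^2$, then there is $\alpha\in\mathbb{R}$ with $f=e^{i\alpha}\varphi$. 2. Consequently $\varphi\notin\mathfrak{C}(a\mathbb{Z}^2)$, and in particular $\mathfrak{C}(a\mathbb{Z}^2)\neq L^2(\mathbb{R})$. 3. If $F\in\mathcal{F}^2(\mathbb{C})$ satisfies $|F(z)|=1$ for all $z\in a\mathbb{Z}+ia\mathbb{Z}$, then there is $\alpha\in\mathbb{R}$ with $F(z)=e^{i\alpha}$ for all $z\in\mathbb{C}$. 4. Statements 1 and 3 correspond to each other under the Bargmann transform: $\mathcal{B}$ is a bijection from $L^2(\mathbb{R})$ onto $\mathcal{F}^2(\mathbb{C})$, and for every $f\in L^2(\mathbb{R})$ one has $|\mathcal{G}f|^2=|\mathcal{G}\varphi|^2$ on $a\mathbb{Z}^2$ if and only if $|\mathcal{B}f|=1$ on $a\mathbb{Z}+ia\mathbb{Z}$, and, for every $\alpha\in\mathbb{R}$, $f=e^{i\alpha}\varphi$ if and only if $\mathcal{B}f(z)=e^{i\alpha}$ for all $z\in\mathbb{C}$. -/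

import Mathlib

open MeasureTheory

/-- The Hilbert space `L²(ℝ)` of complex-valued square-integrable signals. -/
abbrev L2R : Type := Lp ℂ 2 (volume : Measure ℝ)

/-- The Gabor transform
`𝒢f(x, ω) = 2^{1/4} ∫ f(t) e^{-π(t-x)²} e^{-2πitω} dt`. -/
noncomputable def gabor (f : L2R) (p : ℝ × ℝ) : ℂ :=
  (((2 : ℝ) ^ (1 / 4 : ℝ) : ℝ) : ℂ) *
    ∫ t : ℝ, f t * Complex.exp (-(Real.pi : ℂ) * ((t : ℂ) - p.1) ^ 2) *
      Complex.exp (-2 * Real.pi * Complex.I * t * p.2)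

/-- The normalised Gaussian `φ(t) = 2^{1/4} e^{-πt²}` as a function. -/
noncomputable def gaussianFun (t : ℝ) : ℂ :=
  (((2 : ℝ) ^ (1 / 4 : ℝ) * Real.exp (-Real.pi * t ^ 2) : ℝ) : ℂ)

theorem memLp_gaussianFun : MemLp gaussianFun 2 (volume : Measure ℝ) := by
  have hc : Continuous gaussianFun := by unfold gaussianFun; fun_prop
  rw [memLp_two_iff_integrable_sq_norm hc.aestronglyMeasurable]
  have h := (integrable_exp_neg_mul_sq (b := 2 * Real.pi) (by positivity)).const_mul
    (((2 : ℝ) ^ (1 / 4 : ℝ)) ^ 2)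
  refine h.congr (Filter.Eventually.of_forall fun t => ?_)
  simp only [gaussianFun, Complex.norm_real, Real.norm_eq_abs, sq_abs, mul_pow]
  rw [← Real.exp_nat_mul]
  congr 2
  push_cast
  ring

/-- The normalised Gaussian as an element of `L²(ℝ)`. -/
noncomputable def gaussian : L2R := memLp_gaussianFun.toLp gaussianFun

/-- `f ∼ g`: the signals agree up to a global phase, `f = e^{iα} g` for some real `α`. -/
def AgreeUpToGlobalPhase (f g : L2R) : Prop :=
  ∃ α : ℝ, f = Complex.exp (Complex.I * α) • g

/-- The set of counterexamples to uniqueness in Gabor phase retrieval on `Λ`. -/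
def counterexamples (Λ : Set (ℝ × ℝ)) : Set L2R :=
  {f | ∃ g : L2R, (∀ p ∈ Λ, ‖gabor f p‖ = ‖gabor g p‖) ∧ ¬ AgreeUpToGlobalPhase f g}

/-- The square lattice `aℤ²` in the time-frequency plane. -/
def squareLattice (a : ℝ) : Set (ℝ × ℝ) :=
  {p | ∃ m n : ℤ, p = (a * m, a * n)}

/-- The square lattice `aℤ + iaℤ` in the complex plane. -/
def complexSquareLattice (a : ℝ) : Set ℂ :=
  {z | ∃ m n : ℤ, z = (a : ℂ) * m + Complex.I * ((a : ℂ) * n)}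

/-- The Fock space: entire functions `F` with `∫ |F(z)|² e^{-π|z|²} dz < ∞`. -/
def fockSpace : Set (ℂ → ℂ) :=
  {F | Differentiable ℂ F ∧
    Integrable (fun z : ℂ => ‖F z‖ ^ 2 * Real.exp (-Real.pi * ‖z‖ ^ 2)) volume}

/-- The Bargmann transform
`ℬf(z) = 2^{1/4} ∫ f(t) e^{2πtz - πt² - (π/2)z²} dt`. -/
noncomputable def bargmann (f : L2R) (z : ℂ) : ℂ :=
  (((2 : ℝ) ^ (1 / 4 : ℝ) : ℝ) : ℂ) *
    ∫ t : ℝ, f t * Complex.exp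
      (2 * Real.pi * t * z - Real.pi * (t : ℂ) ^ 2 - Real.pi / 2 * z ^ 2)


/-!
Up to a unimodular factor, `𝒢 f (x, ω)` is `ℬ f (x - iω) * exp (-π / 2 * |x - iω| ^ 2)`, so knowing
`|𝒢 f|` on `aℤ²` amounts to knowing `|ℬ f|` on `aℤ + iaℤ`. A function `F` in Fock space satisfies
`|F z| ≤ ‖F‖ * exp (π / 2 * |z| ^ 2)`, hence `z ↦ F (a * z)` has Gaussian type `π / 2 * a ^ 2`,
strictly below the type `π / 2` of the sigma function `σ` of the lattice `ℤ[i]`.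

Such a function is constant as soon as it is bounded on `ℤ[i]`. Since `1 / |σ'|` is summable over
`ℤ[i]`, Lagrange interpolation with `σ` in place of the nodal polynomial gives, for each large
square, an entire `L` that agrees with the function at the lattice points inside and is at most a
constant times `|σ|` away from the lattice. The maximum principle for the difference divided by `σ`
transfers this bound to the function itself, with a constant depending only on its bound on the
lattice. All lattice translates satisfy the same hypotheses, so the function is bounded and
Liouville's theorem applies.

That `ℬ` is isometric is Plancherel's theorem applied to each windowed signal. It is onto because,
by the mean value property, pairing with the transform of a coherent state evaluates any element of
Fock space at a point.
-/

section Plancherel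

open FourierTransform SchwartzMap
open scoped ENNReal

variable {α E F : Type*} [MeasurableSpace α] [NormedAddCommGroup E] [InnerProductSpace ℝ E]
  [FiniteDimensional ℝ E] [MeasurableSpace E] [BorelSpace E]
  [NormedAddCommGroup F] [InnerProductSpace ℂ F] [CompleteSpace F]

theorem eLpNorm_two_sq {G : Type*} [NormedAddCommGroup G] (f : α → G) (μ : Measure α) :
    eLpNorm f 2 μ ^ 2 = ∫⁻ x, ‖f x‖ₑ ^ 2 ∂μ := by
  simpa using eLpNorm_nnreal_pow_eq_lintegral (f := f) (μ := μ) (p := 2) (by norm_num)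

theorem coeFn_fourier_toLp_ae_eq {g : E → F} (h₁ : Integrable g) (h₂ : MemLp g 2) :
    (𝓕 (h₂.toLp g) : Lp F 2 (volume : Measure E)) =ᵐ[volume] 𝓕 g := by
  have hcont : Continuous (𝓕 g) := VectorFourier.fourierIntegral_continuous
    Real.continuous_fourierChar (innerSL ℝ).continuous₂ h₁
  refine ae_eq_of_integral_contDiff_smul_eq
    ((Lp.memLp _).locallyIntegrable (by norm_num)) hcont.locallyIntegrable fun u hu hus ↦ ?_
  let U : 𝓢(E, ℂ) := (hus.comp_left Complex.ofReal_zero).toSchwartzMap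
    (Complex.ofRealCLM.contDiff.comp hu)
  have hU : ∀ x (y : F), U x • y = u x • y := fun _ _ ↦ Complex.coe_smul _ _
  calc ∫ x, u x • (𝓕 (h₂.toLp g) : Lp F 2 (volume : Measure E)) x
      = ∫ x, (𝓕 U) x • (h₂.toLp g) x := by
        simpa only [TemperedDistribution.fourier_apply, Lp.toTemperedDistribution_apply, hU] using
          (congrArg (fun T ↦ T U) (Lp.fourier_toTemperedDistribution_eq (h₂.toLp g))).symm
    _ = ∫ x, (𝓕 (U : E → ℂ)) x • g x := by
        refine integral_congr_ae ?_
        filter_upwards [h₂.coeFn_toLp] with x hx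
        rw [hx, SchwartzMap.fourier_coe]
    _ = ∫ x, U x • 𝓕 g x := by
        have hflip := VectorFourier.integral_fourierIntegral_smul_eq_flip (μ := volume)
          (ν := volume) (L := innerₗ E) Real.continuous_fourierChar continuous_inner U.integrable h₁
        rwa [flip_innerₗ] at hflip
    _ = ∫ x, u x • 𝓕 g x := by simp only [hU]

theorem eLpNorm_fourier_eq {g : E → F} (h₁ : Integrable g) (h₂ : MemLp g 2) :
    eLpNorm (𝓕 g) 2 volume = eLpNorm g 2 volume := by
  rw [← eLpNorm_congr_ae (coeFn_fourier_toLp_ae_eq h₁ h₂), ← eLpNorm_congr_ae h₂.coeFn_toLp,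
    ← Lp.enorm_def, ← Lp.enorm_def, ← ofReal_norm, ← ofReal_norm, Lp.norm_fourier_eq]

theorem lintegral_lintegral_enorm_sq_mul_translate {f g : E → ℂ}
    (hf : AEStronglyMeasurable f) (hg : AEStronglyMeasurable g) :
    ∫⁻ x, ∫⁻ t, ‖f t * g (t - x)‖ₑ ^ 2 = (∫⁻ t, ‖f t‖ₑ ^ 2) * ∫⁻ t, ‖g t‖ₑ ^ 2 := by
  have hfm : AEMeasurable (fun t ↦ ‖f t‖ₑ ^ 2) := hf.enorm.pow_const 2
  rw [lintegral_lintegral_swap, ← lintegral_mul_const'' _ hfm]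
  · refine lintegral_congr fun t ↦ ?_
    have hgt : AEMeasurable fun x ↦ ‖g (t - x)‖ₑ ^ 2 :=
      (hg.comp_measurePreserving (Measure.measurePreserving_sub_left volume t)).enorm.pow_const 2
    simp only [enorm_mul, mul_pow]
    rw [lintegral_const_mul'' _ hgt, lintegral_sub_left_eq_self (fun s ↦ ‖g s‖ₑ ^ 2) t]
  · have hsub : Measure.QuasiMeasurePreserving (fun p : E × E ↦ p.2 - p.1)
        (volume.prod volume) volume :=
      (quasiMeasurePreserving_sub_of_right_invariant volume volume).comp
        Measure.measurePreserving_swap.quasiMeasurePreserving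
    exact (hf.comp_snd.mul (hg.comp_quasiMeasurePreserving hsub)).enorm.pow_const 2

theorem lintegral_lintegral_enorm_fourier_mul_translate_sq {f g : E → ℂ} (hf : MemLp f 2)
    (hg : MemLp g 2) (hg' : MemLp g ∞) :
    ∫⁻ x, ∫⁻ ω, ‖𝓕 (fun t ↦ f t * g (t - x)) ω‖ₑ ^ 2 =
      (∫⁻ t, ‖f t‖ₑ ^ 2) * ∫⁻ t, ‖g t‖ₑ ^ 2 := by
  rw [← lintegral_lintegral_enorm_sq_mul_translate hf.1 hg.1]
  refine lintegral_congr fun x ↦ ?_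
  have hsub := measurePreserving_sub_right (volume : Measure E) x
  have h₁ : Integrable fun t ↦ f t * g (t - x) :=
    hf.integrable_mul (hg.comp_measurePreserving hsub)
  have h₂ : MemLp (fun t ↦ f t * g (t - x)) 2 := (hg'.comp_measurePreserving hsub).mul' hf
  rw [← eLpNorm_two_sq, ← eLpNorm_two_sq, eLpNorm_fourier_eq h₁ h₂]

end Plancherel

section CircleAverage

open Real

theorem circleAverage_zero_norm {E : Type*} [NormedAddCommGroup E] [NormedSpace ℝ E]
    (g : ℂ → E) (z : ℂ) : circleAverage g 0 ‖z‖ =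
      (2 * π)⁻¹ • ∫ θ in 0..2 * π, g (Complex.exp (θ * Complex.I) * z) := by
  rw [circleAverage_eq_integral_add z.arg]
  congr 1
  refine intervalIntegral.integral_congr fun θ _ ↦ ?_
  simp only [circleMap, zero_add]
  rw [Complex.ofReal_add, add_mul, Complex.exp_add, mul_left_comm, Complex.norm_mul_exp_arg_mul_I]

theorem integral_eq_integral_circleAverage {E : Type*} [NormedAddCommGroup E] [NormedSpace ℝ E]
    [CompleteSpace E] {g : ℂ → E} (hg : Integrable g) :
    ∫ z, g z = ∫ z : ℂ, circleAverage g 0 ‖z‖ := by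
  have hrot (θ : ℝ) : MeasurePreserving (fun z : ℂ ↦ Complex.exp (θ * Complex.I) * z) :=
    (rotation (Circle.exp θ)).measurePreserving
  have hfin : IsFiniteMeasure (volume.restrict (Set.uIoc 0 (2 * π))) :=
    inferInstanceAs (IsFiniteMeasure (volume.restrict (Set.Ioc _ _)))
  have hskew := (MeasurePreserving.id (volume.restrict (Set.uIoc 0 (2 * π)))).skew_product
    (g := fun (θ : ℝ) (z : ℂ) ↦ Complex.exp (θ * Complex.I) * z) (μc := volume) (μd := volume)
    (by fun_prop) (.of_forall fun θ ↦ (hrot θ).map_eq)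
  have hint (θ : ℝ) : ∫ z, g (Complex.exp (θ * Complex.I) * z) = ∫ z, g z :=
    (hrot θ).integral_comp (rotation (Circle.exp θ)).toHomeomorph.measurableEmbedding g
  have hswap : Integrable (Function.uncurry fun (θ : ℝ) z ↦ g (Complex.exp (θ * Complex.I) * z))
      ((volume.restrict (Set.uIoc 0 (2 * π))).prod volume) :=
    hskew.integrable_comp_of_integrable (hg.comp_snd _)
  simp only [circleAverage_zero_norm]
  rw [integral_smul, ← intervalIntegral_integral_swap hswap]
  simp only [hint]
  rw [intervalIntegral.integral_const, sub_zero, inv_smul_smul₀ two_pi_pos.ne']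

theorem integral_radial_smul_eq {E : Type*} [NormedAddCommGroup E] [NormedSpace ℂ E]
    [CompleteSpace E] {F : ℂ → E} (hF : Differentiable ℂ F) (ρ : ℝ → ℝ)
    (h : Integrable fun z : ℂ ↦ ρ ‖z‖ • F z) :
    ∫ z : ℂ, ρ ‖z‖ • F z = (∫ z : ℂ, ρ ‖z‖) • F 0 := by
  rw [integral_eq_integral_circleAverage h, ← integral_smul_const]
  refine integral_congr_ae (.of_forall fun z ↦ ?_)
  have hmean : circleAverage F 0 ‖z‖ = F 0 := hF.diffContOnCl.circleAverage
  dsimp only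
  rw [← hmean, ← circleAverage_fun_smul]
  refine circleAverage_congr_sphere fun w hw ↦ ?_
  rw [mem_sphere_zero_iff_norm.1 hw, abs_norm]

end CircleAverage

theorem exp_mul_mul_abs_le {x r : ℝ} (h : |x| ≤ r) (t : ℝ) :
    Real.exp (x * t) * |t| ≤ Real.exp ((r + 1) * t) + Real.exp (-(r + 1) * t) := by
  have hxt : x * t ≤ r * |t| :=
    (le_abs_self _).trans ((abs_mul x t).trans_le (mul_le_mul_of_nonneg_right h (abs_nonneg t)))
  calc Real.exp (x * t) * |t| ≤ Real.exp (r * |t|) * Real.exp |t| :=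
        mul_le_mul (Real.exp_le_exp.2 hxt) (by linarith [Real.add_one_le_exp |t|])
          (abs_nonneg t) (Real.exp_nonneg _)
    _ = Real.exp ((r + 1) * |t|) := by rw [← Real.exp_add]; congr 1; ring
    _ ≤ Real.exp ((r + 1) * t) + Real.exp (-(r + 1) * t) := by
        rcases abs_choice t with ht | ht <;> rw [ht]
        · linarith [Real.exp_pos (-(r + 1) * t)]
        · rw [mul_neg, ← neg_mul]; linarith [Real.exp_pos ((r + 1) * t)]

theorem differentiable_integral_cexp_smul {E : Type*} [NormedAddCommGroup E] [NormedSpace ℂ E]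
    {μ : Measure ℝ} {f : ℝ → E} (hf : ∀ c : ℝ, Integrable (fun t ↦ Real.exp (c * t) • f t) μ) :
    Differentiable ℂ fun z : ℂ ↦ ∫ t, Complex.exp (z * t) • f t ∂μ := by
  intro z₀
  have hfm : AEStronglyMeasurable f μ := by simpa using (hf 0).1
  have hmeas (z : ℂ) : AEStronglyMeasurable (fun t : ℝ ↦ Complex.exp (z * t) • f t) μ :=
    Continuous.aestronglyMeasurable (by fun_prop) |>.smul hfm
  have hint : Integrable (fun t : ℝ ↦ Complex.exp (z₀ * t) • f t) μ :=
    (hf z₀.re).congr' (hmeas z₀) (.of_forall fun t ↦ by simp [norm_smul, Complex.norm_exp])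
  have hderiv (t : ℝ) (z : ℂ) :
      HasDerivAt (fun z ↦ Complex.exp (z * t) • f t) ((Complex.exp (z * t) * t) • f t) z :=
    (hasDerivAt_mul_const (t : ℂ)).cexp.smul_const (f t)
  set c := ‖z₀‖ + 1 + 1
  have hbound (t : ℝ) (z : ℂ) (hz : z ∈ Metric.ball z₀ 1) :
      ‖(Complex.exp (z * t) * t) • f t‖ ≤
        ‖Real.exp (c * t) • f t‖ + ‖Real.exp (-c * t) • f t‖ := by
    have hre : |z.re| ≤ ‖z₀‖ + 1 := (Complex.abs_re_le_norm z).trans <| by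
      linarith [norm_le_norm_add_norm_sub' z z₀, mem_ball_iff_norm.1 hz]
    simp only [norm_smul, norm_mul, Complex.norm_exp, Complex.re_mul_ofReal, Complex.norm_real,
      Real.norm_eq_abs, Real.abs_exp, ← add_mul]
    exact mul_le_mul_of_nonneg_right (exp_mul_mul_abs_le hre t) (norm_nonneg _)
  exact (hasDerivAt_integral_of_dominated_loc_of_deriv_le (Metric.ball_mem_nhds z₀ one_pos)
    (.of_forall hmeas) hint (Continuous.aestronglyMeasurable (by fun_prop) |>.smul hfm)
    (.of_forall hbound) ((hf c).norm.add (hf (-c)).norm)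
    (.of_forall fun t z _ ↦ hderiv t z)).2.differentiableAt

section Bargmann

open Complex
open scoped Real ComplexConjugate

/-- The integral kernel of the Bargmann transform, `2^{1/4} e^{2πtz - πt² - (π/2)z²}`. -/
noncomputable def bargmannKernel (z : ℂ) (t : ℝ) : ℂ :=
  ((2 : ℝ) ^ (1 / 4 : ℝ) : ℝ) * cexp (2 * π * t * z - π * (t : ℂ) ^ 2 - π / 2 * z ^ 2)

theorem continuous_gaussianFun : Continuous gaussianFun := by
  unfold gaussianFun; fun_prop

theorem norm_gaussianFun (t : ℝ) :
    ‖gaussianFun t‖ = 2 ^ (1 / 4 : ℝ) * Real.exp (-π * t ^ 2) := by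
  rw [gaussianFun, norm_real, Real.norm_of_nonneg (by positivity)]

theorem bargmannKernel_zero : bargmannKernel 0 = gaussianFun := by
  funext t
  simp [bargmannKernel, gaussianFun]

theorem continuous_bargmannKernel (z : ℂ) : Continuous (bargmannKernel z) := by
  unfold bargmannKernel; fun_prop

theorem conj_bargmannKernel (z : ℂ) (t : ℝ) :
    conj (bargmannKernel z t) = bargmannKernel (conj z) t := by
  simp [bargmannKernel, ← exp_conj, map_ofNat]

theorem bargmannKernel_eq_mul_gaussianFun (z : ℂ) (t : ℝ) :
    bargmannKernel z t = cexp (-(π / 2 * z ^ 2)) * (cexp (2 * π * z * t) * gaussianFun t) := by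
  rw [bargmannKernel, gaussianFun]
  push_cast
  rw [mul_left_comm (cexp (2 * π * z * t)), mul_left_comm, ← exp_add, ← exp_add]
  ring_nf

theorem bargmannKernel_mul_bargmannKernel (z w : ℂ) (t : ℝ) :
    bargmannKernel z t * bargmannKernel w t = ((√2 : ℝ) : ℂ) *
      cexp (-(2 * π) * t ^ 2 + 2 * π * (z + w) * t + -(π / 2 * (z ^ 2 + w ^ 2))) := by
  have hroot : (((2 : ℝ) ^ (1 / 4 : ℝ) : ℝ) : ℂ) * ((2 : ℝ) ^ (1 / 4 : ℝ) : ℝ) = (√2 : ℝ) := by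
    rw [← ofReal_mul, ← Real.rpow_add two_pos, Real.sqrt_eq_rpow]
    norm_num
  rw [bargmannKernel, bargmannKernel, mul_mul_mul_comm, hroot, ← exp_add]
  ring_nf

theorem integral_bargmannKernel_mul_bargmannKernel (z w : ℂ) :
    ∫ t, bargmannKernel z t * bargmannKernel w t = cexp (π * z * w) := by
  have hpi : (π : ℂ) ≠ 0 := ofReal_ne_zero.2 Real.pi_ne_zero
  have hroot : (π / -(-(2 * π)) : ℂ) ^ (1 / 2 : ℂ) = ((√2)⁻¹ : ℝ) := by
    rw [show (π / -(-(2 * π)) : ℂ) = ((2⁻¹ : ℝ) : ℂ) by push_cast; field_simp,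
      show (1 / 2 : ℂ) = ((1 / 2 : ℝ) : ℂ) by push_cast; rfl, ← ofReal_cpow (by norm_num),
      ← Real.sqrt_eq_rpow, Real.sqrt_inv]
  simp_rw [bargmannKernel_mul_bargmannKernel]
  rw [integral_const_mul, integral_cexp_quadratic (by simp [Real.pi_pos]), hroot, ← mul_assoc,
    ← ofReal_mul, mul_inv_cancel₀ (by positivity), ofReal_one, one_mul]
  congr 1
  field_simp
  ring

theorem norm_bargmannKernel (z : ℂ) (t : ℝ) :
    ‖bargmannKernel z t‖ = Real.exp (π / 2 * ‖z‖ ^ 2) * ‖gaussianFun (t - z.re)‖ := by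
  have hre : (2 * π * t * z - π * (t : ℂ) ^ 2 - π / 2 * z ^ 2).re =
      π / 2 * (z.re ^ 2 + z.im ^ 2) + -π * (t - z.re) ^ 2 := by
    rw [← re_add_im z]
    simp [sq]
    ring
  rw [bargmannKernel, norm_mul, norm_exp, hre, Real.exp_add, norm_gaussianFun, norm_real,
    Real.norm_of_nonneg (by positivity), Complex.sq_norm, normSq_apply]
  ring_nf

theorem memLp_bargmannKernel (z : ℂ) : MemLp (bargmannKernel z) 2 :=
  ((memLp_gaussianFun.comp_measurePreserving (measurePreserving_sub_right volume z.re)).const_mul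
    (Real.exp (π / 2 * ‖z‖ ^ 2) : ℂ)).congr_norm (continuous_bargmannKernel z).aestronglyMeasurable
    (.of_forall fun t ↦ by
      simp only [norm_bargmannKernel, norm_mul, norm_real, Real.norm_eq_abs, Real.abs_exp,
        Function.comp_apply])

theorem memLp_top_gaussianFun : MemLp gaussianFun ⊤ :=
  memLp_top_of_bound continuous_gaussianFun.aestronglyMeasurable (2 ^ (1 / 4 : ℝ))
    (.of_forall fun t ↦ by
      rw [norm_gaussianFun]
      exact mul_le_of_le_one_right (by positivity)
        (Real.exp_le_one_iff.2 (by nlinarith [Real.pi_pos, sq_nonneg t])))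

theorem bargmann_eq_integral (f : L2R) (z : ℂ) : bargmann f z = ∫ t, f t * bargmannKernel z t := by
  rw [bargmann, ← integral_const_mul]
  exact integral_congr_ae (.of_forall fun t ↦ mul_left_comm _ _ _)

theorem integrable_mul_bargmannKernel (f : L2R) (z : ℂ) :
    Integrable fun t ↦ f t * bargmannKernel z t :=
  (Lp.memLp f).integrable_mul (memLp_bargmannKernel z)

theorem differentiable_bargmann (f : L2R) : Differentiable ℂ (bargmann f) := by
  have hexp (c : ℝ) : Integrable fun t : ℝ ↦ Real.exp (c * t) • (gaussianFun t * f t) := by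
    refine ((integrable_mul_bargmannKernel f (c / (2 * π))).const_mul
      (cexp (π / 2 * (c / (2 * π)) ^ 2))).congr (.of_forall fun t ↦ ?_)
    simp only [bargmannKernel_eq_mul_gaussianFun, real_smul]
    rw [mul_left_comm (f t), ← mul_assoc, ← exp_add, add_neg_cancel, exp_zero, one_mul,
      mul_div_cancel₀ _ (by simp)]
    push_cast
    ring
  have hbargmann : bargmann f = fun z ↦ cexp (-(π / 2 * z ^ 2)) *
      ∫ t : ℝ, cexp (2 * π * z * t) • (gaussianFun t * f t) := by
    funext z
    rw [bargmann_eq_integral, ← integral_const_mul]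
    refine integral_congr_ae (.of_forall fun t ↦ ?_)
    simp only [bargmannKernel_eq_mul_gaussianFun, smul_eq_mul]
    ring
  have hlaplace : Differentiable ℂ fun z : ℂ ↦
      ∫ t : ℝ, cexp (2 * π * z * t) • (gaussianFun t * f t) :=
    (differentiable_integral_cexp_smul hexp).comp (differentiable_id.const_mul (2 * π : ℂ))
  rw [hbargmann]
  fun_prop

/-- The coherent state at `w`, the vector of `L²(ℝ)` that represents the evaluation
`f ↦ bargmann f w`; the inner product is conjugate-linear in its first argument, whence the
conjugate. -/
noncomputable def coherent (w : ℂ) : L2R :=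
  (memLp_bargmannKernel (conj w)).toLp (bargmannKernel (conj w))

theorem coeFn_coherent (w : ℂ) : coherent w =ᵐ[volume] bargmannKernel (conj w) :=
  (memLp_bargmannKernel (conj w)).coeFn_toLp

theorem coherent_zero : coherent 0 = gaussian := by
  simp only [coherent, gaussian, map_zero, bargmannKernel_zero]

theorem inner_coherent (f : L2R) (z : ℂ) : inner ℂ (coherent z) f = bargmann f z := by
  rw [L2.inner_def, bargmann_eq_integral]
  refine integral_congr_ae ?_
  filter_upwards [coeFn_coherent z] with t ht
  rw [ht, RCLike.inner_apply, conj_bargmannKernel, conj_conj]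

theorem bargmann_coherent (w z : ℂ) : bargmann (coherent w) z = cexp (π * z * conj w) := by
  rw [bargmann_eq_integral, mul_right_comm, ← integral_bargmannKernel_mul_bargmannKernel]
  refine integral_congr_ae ?_
  filter_upwards [coeFn_coherent w] with t ht
  rw [ht]

theorem bargmann_gaussian (z : ℂ) : bargmann gaussian z = 1 := by
  rw [← coherent_zero, bargmann_coherent, map_zero, mul_zero, exp_zero]

theorem norm_coherent (z : ℂ) : ‖coherent z‖ = Real.exp (π / 2 * ‖z‖ ^ 2) := by
  have hsq : ‖coherent z‖ ^ 2 = Real.exp (π * ‖z‖ ^ 2) := by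
    have h := bargmann_coherent z z
    rw [← inner_coherent, inner_self_eq_norm_sq_to_K, mul_assoc, mul_conj,
      normSq_eq_norm_sq] at h
    refine ofReal_injective ?_
    push_cast at h ⊢
    exact h
  rw [← sq_eq_sq₀ (norm_nonneg _) (Real.exp_nonneg _), hsq, ← Real.exp_nat_mul]
  congr 1
  push_cast
  ring

theorem norm_bargmann_le (f : L2R) (z : ℂ) :
    ‖bargmann f z‖ ≤ ‖f‖ * Real.exp (π / 2 * ‖z‖ ^ 2) := by
  rw [← inner_coherent, ← norm_coherent, mul_comm]
  exact norm_inner_le_norm _ _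

end Bargmann

section FockSpace

open Complex
open scoped Real ComplexConjugate FourierTransform

/-- The function `F` times the square root `e^{-(π/2)|z|²}` of the Fock space weight, so that the
Fock space norm of `F` is the `L²(ℂ)` norm of `fockWeighted F`. -/
noncomputable def fockWeighted (F : ℂ → ℂ) (z : ℂ) : ℂ :=
  F z * (Real.exp (-(π / 2 * ‖z‖ ^ 2)) : ℝ)

theorem continuous_fockWeighted {F : ℂ → ℂ} (hF : Continuous F) : Continuous (fockWeighted F) := by
  unfold fockWeighted; fun_prop

theorem norm_fockWeighted (F : ℂ → ℂ) (z : ℂ) :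
    ‖fockWeighted F z‖ = ‖F z‖ * Real.exp (-(π / 2 * ‖z‖ ^ 2)) := by
  rw [fockWeighted, norm_mul, norm_real, Real.norm_of_nonneg (Real.exp_nonneg _)]

theorem mem_fockSpace_iff {F : ℂ → ℂ} :
    F ∈ fockSpace ↔ Differentiable ℂ F ∧ MemLp (fockWeighted F) 2 := by
  refine and_congr_right fun hF ↦ ?_
  rw [memLp_two_iff_integrable_sq_norm (continuous_fockWeighted hF.continuous).aestronglyMeasurable]
  refine iff_of_eq (congrArg (fun g ↦ Integrable g volume) (funext fun z ↦ ?_))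
  rw [norm_fockWeighted, mul_pow, ← Real.exp_nat_mul]
  congr 2
  push_cast
  ring

theorem gabor_eq_fourier (f : L2R) (x ω : ℝ) :
    gabor f (x, ω) = 𝓕 (fun t ↦ f t * gaussianFun (t - x)) ω := by
  rw [gabor, Real.fourier_real_eq_integral_exp_smul, ← integral_const_mul]
  refine integral_congr_ae (.of_forall fun t ↦ ?_)
  simp only [gaussianFun, smul_eq_mul]
  push_cast
  ring_nf

theorem gabor_eq_bargmann (f : L2R) (x ω : ℝ) :
    gabor f (x, ω) = cexp (-(π / 2 * (x ^ 2 + ω ^ 2) : ℝ) + (-(π * x * ω) : ℝ) * I) *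
      bargmann f (x - ω * I) := by
  rw [gabor, bargmann, mul_left_comm]
  congr 1
  rw [← integral_const_mul]
  refine integral_congr_ae (.of_forall fun t ↦ ?_)
  simp only
  rw [mul_assoc, ← exp_add, mul_left_comm, ← exp_add]
  congr 2
  push_cast
  linear_combination (π / 2 * ω ^ 2 : ℂ) * I_sq

theorem norm_gabor (f : L2R) (x ω : ℝ) :
    ‖gabor f (x, ω)‖ = ‖fockWeighted (bargmann f) (x - ω * I)‖ := by
  have hnorm : ‖(x - ω * I : ℂ)‖ ^ 2 = x ^ 2 + ω ^ 2 := by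
    rw [Complex.sq_norm, normSq_apply]
    simp [sq]
  rw [gabor_eq_bargmann, norm_fockWeighted, hnorm, norm_mul, exp_add, norm_mul,
    norm_exp_ofReal_mul_I, mul_one, ← ofReal_neg, norm_exp_ofReal, mul_comm]

theorem lintegral_complex_eq_lintegral_sub_mul_I {u : ℂ → ENNReal} (hu : Measurable u) :
    ∫⁻ z, u z = ∫⁻ x : ℝ, ∫⁻ ω : ℝ, u (x - ω * I) := by
  rw [← volume_preserving_equiv_real_prod.symm.lintegral_comp_emb
      measurableEquivRealProd.symm.measurableEmbedding, Measure.volume_eq_prod, lintegral_prod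
      (fun p ↦ u (measurableEquivRealProd.symm p)) (by fun_prop)]
  refine lintegral_congr fun x ↦ ?_
  rw [← lintegral_neg_eq_self (fun ω : ℝ ↦ u (x - ω * I))]
  refine lintegral_congr fun ω ↦ ?_
  rw [measurableEquivRealProd_symm_apply, mk_eq_add_mul_I, ofReal_neg, neg_mul, sub_neg_eq_add]

theorem lintegral_enorm_gaussianFun_sq : ∫⁻ t, ‖gaussianFun t‖ₑ ^ 2 = 1 := by
  have hnorm : ‖gaussian‖ = 1 := by rw [← coherent_zero, norm_coherent]; simp
  rw [← eLpNorm_two_sq, ← eLpNorm_congr_ae memLp_gaussianFun.coeFn_toLp, ← Lp.enorm_def]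
  change ‖gaussian‖ₑ ^ 2 = 1
  rw [← ofReal_norm, hnorm, ENNReal.ofReal_one, one_pow]

theorem eLpNorm_fockWeighted_bargmann (f : L2R) :
    eLpNorm (fockWeighted (bargmann f)) 2 volume = eLpNorm f 2 volume := by
  refine (ENNReal.pow_right_strictMono two_ne_zero).injective ?_
  have hmeas : Measurable fun z ↦ ‖fockWeighted (bargmann f) z‖ₑ ^ 2 :=
    (continuous_fockWeighted (differentiable_bargmann f).continuous).measurable.enorm.pow_const 2
  have hgabor (x ω : ℝ) : ‖fockWeighted (bargmann f) (x - ω * I)‖ₑ =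
      ‖𝓕 (fun t ↦ f t * gaussianFun (t - x)) ω‖ₑ := by
    rw [← ofReal_norm, ← ofReal_norm, ← norm_gabor, gabor_eq_fourier]
  simp only [eLpNorm_two_sq]
  rw [lintegral_complex_eq_lintegral_sub_mul_I hmeas]
  simp only [hgabor]
  rw [lintegral_lintegral_enorm_fourier_mul_translate_sq (Lp.memLp f) memLp_gaussianFun
    memLp_top_gaussianFun, lintegral_enorm_gaussianFun_sq, mul_one]

theorem memLp_fockWeighted_bargmann (f : L2R) : MemLp (fockWeighted (bargmann f)) 2 :=
  ⟨(continuous_fockWeighted (differentiable_bargmann f).continuous).aestronglyMeasurable, by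
    rw [eLpNorm_fockWeighted_bargmann]; exact (Lp.memLp f).2⟩

theorem bargmann_add (f g : L2R) (z : ℂ) : bargmann (f + g) z = bargmann f z + bargmann g z := by
  simp only [← inner_coherent, inner_add_right]

theorem bargmann_smul (c : ℂ) (f : L2R) (z : ℂ) : bargmann (c • f) z = c * bargmann f z := by
  simp only [← inner_coherent, inner_smul_right]

/-- The Bargmann transform as a linear isometry of `L²(ℝ)` into `L²(ℂ)`; the weight turns the
Fock space norm into the norm of `L²(ℂ)`. -/
noncomputable def bargmannIsometry : L2R →ₗᵢ[ℂ] Lp ℂ 2 (volume : Measure ℂ) where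
  toFun f := (memLp_fockWeighted_bargmann f).toLp _
  map_add' f g := by
    rw [← MemLp.toLp_add]
    congr 1
    funext z
    simp only [fockWeighted, bargmann_add, add_mul, Pi.add_apply]
  map_smul' c f := by
    rw [RingHom.id_apply, ← MemLp.toLp_const_smul]
    congr 1
    funext z
    simp only [fockWeighted, bargmann_smul, Pi.smul_apply, smul_eq_mul, mul_assoc]
  norm_map' f := by
    change ‖(memLp_fockWeighted_bargmann f).toLp _‖ = ‖f‖
    rw [Lp.norm_toLp, eLpNorm_fockWeighted_bargmann, Lp.norm_def]

theorem coeFn_bargmannIsometry (f : L2R) :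
    bargmannIsometry f =ᵐ[volume] fockWeighted (bargmann f) :=
  (memLp_fockWeighted_bargmann f).coeFn_toLp

theorem integral_exp_neg_pi_mul_sq_norm : ∫ z : ℂ, Real.exp (-π * ‖z‖ ^ 2) = 1 := by
  rw [GaussianFourier.integral_rexp_neg_mul_sq_norm Real.pi_pos, div_self Real.pi_ne_zero,
    Real.one_rpow]

theorem fockWeighted_mul_conj_fockWeighted_coherent (F : ℂ → ℂ) (z w : ℂ) :
    fockWeighted F (z + w) * conj (fockWeighted (bargmann (coherent w)) (z + w)) =
      Real.exp (-π * ‖z‖ ^ 2) • (F (z + w) * cexp (-(π * z * conj w))) := by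
  have hsq (u : ℂ) : (‖u‖ : ℂ) ^ 2 = u * conj u := by
    rw [mul_conj, normSq_eq_norm_sq, ofReal_pow]
  simp only [fockWeighted, bargmann_coherent, map_mul, conj_ofReal, ← exp_conj, conj_conj,
    real_smul]
  simp only [ofReal_exp, ofReal_mul, ofReal_neg, ofReal_div, ofReal_pow, ofReal_ofNat, hsq, map_add]
  rw [mul_left_comm, mul_assoc, mul_assoc, ← exp_add, mul_left_comm (cexp _) (F _), ← exp_add,
    mul_left_comm (cexp _) (F _), ← exp_add]
  ring_nf

theorem inner_bargmannIsometry_coherent {F : ℂ → ℂ} (hF : Differentiable ℂ F)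
    (h₂ : MemLp (fockWeighted F) 2) (w : ℂ) :
    inner ℂ (bargmannIsometry (coherent w)) (h₂.toLp (fockWeighted F)) = F w := by
  set G : ℂ → ℂ := fun z ↦ F (z + w) * cexp (-(π * z * conj w)) with hG
  have hGd : Differentiable ℂ G := by fun_prop
  have hinner : inner ℂ (bargmannIsometry (coherent w)) (h₂.toLp (fockWeighted F)) =
      ∫ z, fockWeighted F z * conj (fockWeighted (bargmann (coherent w)) z) := by
    rw [L2.inner_def]
    refine integral_congr_ae ?_
    filter_upwards [h₂.coeFn_toLp, coeFn_bargmannIsometry (coherent w)] with z h₃ h₄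
    rw [h₃, h₄, RCLike.inner_apply]
  have hint : Integrable fun z ↦ Real.exp (-π * ‖z‖ ^ 2) • G z := by
    simpa only [Pi.star_apply, RCLike.star_def, Pi.mul_apply, hG,
      fockWeighted_mul_conj_fockWeighted_coherent] using
      (h₂.integrable_mul (memLp_fockWeighted_bargmann (coherent w)).star).comp_add_right w
  rw [hinner, ← integral_add_right_eq_self _ w]
  simp only [fockWeighted_mul_conj_fockWeighted_coherent]
  rw [integral_radial_smul_eq hGd (fun r ↦ Real.exp (-π * r ^ 2)) hint,
    integral_exp_neg_pi_mul_sq_norm, one_smul, hG]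
  simp

theorem bargmann_injective : Function.Injective bargmann := fun f g h ↦ by
  refine bargmannIsometry.injective (Lp.ext ?_)
  filter_upwards [coeFn_bargmannIsometry f, coeFn_bargmannIsometry g] with z hf hg
  rw [hf, hg, h]

-- The adjoint inverts the transform, because it turns evaluation of `bargmann f` into the pairing
-- of `F` with the transformed coherent state.
theorem exists_bargmann_eq {F : ℂ → ℂ} (hF : F ∈ fockSpace) : ∃ f : L2R, bargmann f = F := by
  obtain ⟨hd, h₂⟩ := mem_fockSpace_iff.1 hF
  refine ⟨bargmannIsometry.toContinuousLinearMap.adjoint (h₂.toLp (fockWeighted F)),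
    funext fun w ↦ ?_⟩
  rw [← inner_coherent, ContinuousLinearMap.adjoint_inner_right]
  exact inner_bargmannIsometry_coherent hd h₂ w

theorem bijOn_bargmann : Set.BijOn bargmann Set.univ fockSpace :=
  ⟨fun f _ ↦ mem_fockSpace_iff.2 ⟨differentiable_bargmann f, memLp_fockWeighted_bargmann f⟩,
    bargmann_injective.injOn,
    fun _ hF ↦ (exists_bargmann_eq hF).imp fun _ h ↦ ⟨trivial, h⟩⟩

end FockSpace

section QProduct

variable {q : ℂ}

/-- The infinite product `∏ (1 - qⁿ w)`, that is, the `q`-Pochhammer symbol `(w; q)_∞`, written in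
the form `1 + _` of Mathlib's convergence criteria. -/
noncomputable def qProd (q w : ℂ) : ℂ := ∏' n : ℕ, (1 + -(q ^ n * w))

theorem summable_norm_neg_pow_mul (hq : ‖q‖ < 1) (w : ℂ) :
    Summable fun n : ℕ ↦ ‖-(q ^ n * w)‖ := by
  simp_rw [norm_neg, norm_mul, norm_pow]
  exact (summable_geometric_of_lt_one (norm_nonneg _) hq).mul_right _

theorem qProd_eq_one_sub_mul (hq : ‖q‖ < 1) (w : ℂ) : qProd q w = (1 - w) * qProd q (q * w) := by
  have hshift (n : ℕ) : q ^ (n + 1) * w = q ^ n * (q * w) := by ring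
  rw [qProd, tprod_eq_zero_mul']
  · simp_rw [hshift]
    rw [pow_zero, one_mul, ← sub_eq_add_neg, qProd]
  · simp_rw [hshift]
    exact multipliable_one_add_of_summable (summable_norm_neg_pow_mul hq _)

theorem exists_pow_mul_eq_one_of_qProd_eq_zero (hq : ‖q‖ < 1) {w : ℂ} (h : qProd q w = 0) :
    ∃ n : ℕ, q ^ n * w = 1 := by
  by_contra! hne
  exact tprod_one_add_ne_zero_of_summable (fun n hn ↦ hne n (by linear_combination -hn))
    (summable_norm_neg_pow_mul hq w) h

theorem qProd_self_ne_zero (hq : ‖q‖ < 1) : qProd q q ≠ 0 := fun h ↦ by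
  obtain ⟨n, hn⟩ := exists_pow_mul_eq_one_of_qProd_eq_zero hq h
  have hnorm : ‖q‖ ^ (n + 1) = 1 := by rw [← norm_pow, pow_succ, hn, norm_one]
  exact (pow_lt_one₀ (norm_nonneg q) hq n.succ_ne_zero).ne hnorm

theorem differentiable_qProd (hq : ‖q‖ < 1) : Differentiable ℂ (qProd q) := by
  intro w₀
  have hprod : HasProdLocallyUniformlyOn (fun (n : ℕ) (w : ℂ) ↦ 1 + -(q ^ n * w)) (qProd q)
      (Metric.ball 0 (‖w₀‖ + 1)) := by
    refine Summable.hasProdLocallyUniformlyOn_nat_one_add (u := fun n ↦ ‖q‖ ^ n * (‖w₀‖ + 1))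
      Metric.isOpen_ball ((summable_geometric_of_lt_one (norm_nonneg _) hq).mul_right _)
      (.of_forall fun n w hw ↦ ?_) fun n ↦ by fun_prop
    rw [norm_neg, norm_mul, norm_pow]
    exact mul_le_mul_of_nonneg_left (mem_ball_zero_iff.1 hw).le (by positivity)
  have hdiff := hprod.differentiableOn (.of_forall fun s ↦ by
    simpa [Finset.prod_fn] using DifferentiableOn.finsetProd (fun _ _ ↦ by fun_prop))
    Metric.isOpen_ball
  exact hdiff.differentiableAt (Metric.isOpen_ball.mem_nhds (by simp))

/-- The Jacobi theta function in its multiplicative variable,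
`∏ (1 - qⁿ w) (1 - qⁿ⁺¹ w⁻¹)`. -/
noncomputable def qTheta (q w : ℂ) : ℂ := qProd q w * qProd q (q * w⁻¹)

theorem qTheta_eq_one_sub_mul (hq : ‖q‖ < 1) (w : ℂ) :
    qTheta q w = (1 - w) * (qProd q (q * w) * qProd q (q * w⁻¹)) := by
  rw [qTheta, qProd_eq_one_sub_mul hq, mul_assoc]

theorem qTheta_mul_left (hq : ‖q‖ < 1) (hq₀ : q ≠ 0) {w : ℂ} (hw : w ≠ 0) :
    qTheta q (q * w) = -w⁻¹ * qTheta q w := by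
  rw [qTheta_eq_one_sub_mul hq w, qTheta, show q * (q * w)⁻¹ = w⁻¹ by field_simp,
    qProd_eq_one_sub_mul hq w⁻¹]
  field_simp
  ring

theorem exists_eq_zpow_of_qTheta_eq_zero (hq : ‖q‖ < 1) {w : ℂ} (h : qTheta q w = 0) :
    ∃ k : ℤ, w = q ^ k := by
  rcases mul_eq_zero.1 h with h | h
  · obtain ⟨n, hn⟩ := exists_pow_mul_eq_one_of_qProd_eq_zero hq h
    exact ⟨-n, by rw [zpow_neg, zpow_natCast]; exact eq_inv_of_mul_eq_one_right hn⟩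
  · obtain ⟨n, hn⟩ := exists_pow_mul_eq_one_of_qProd_eq_zero hq h
    refine ⟨(n + 1 : ℕ), ?_⟩
    rw [zpow_natCast, pow_succ]
    exact (eq_of_mul_inv_eq_one (by rw [mul_assoc]; exact hn)).symm

theorem differentiableAt_qTheta (hq : ‖q‖ < 1) {w : ℂ} (hw : w ≠ 0) :
    DifferentiableAt ℂ (qTheta q) w := by
  have := differentiable_qProd hq
  unfold qTheta
  fun_prop (disch := exact hw)

theorem hasDerivAt_qTheta_one (hq : ‖q‖ < 1) :
    HasDerivAt (qTheta q) (-qProd q q ^ 2) 1 := by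
  have hrest : DifferentiableAt ℂ (fun w ↦ qProd q (q * w) * qProd q (q * w⁻¹)) 1 := by
    have := differentiable_qProd hq
    fun_prop (disch := exact one_ne_zero)
  rw [funext (qTheta_eq_one_sub_mul hq)]
  refine (((hasDerivAt_id' (1 : ℂ)).const_sub 1).fun_mul hrest.hasDerivAt).congr_deriv ?_
  simp [sq]

end QProduct

section SquareSigma

open Complex
open scoped Real ComplexConjugate

theorem norm_fockWeighted_add {F : ℂ → ℂ} {z p : ℂ}
    (h : F (z + p) = -(cexp (π * (conj p * z + ‖p‖ ^ 2 / 2)) * F z)) :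
    ‖fockWeighted F (z + p)‖ = ‖fockWeighted F z‖ := by
  have hre : (π * (conj p * z + ‖p‖ ^ 2 / 2) : ℂ).re + -(π / 2 * ‖z + p‖ ^ 2) =
      -(π / 2 * ‖z‖ ^ 2) := by
    rw [re_ofReal_mul, add_re, show (‖p‖ ^ 2 / 2 : ℂ) = ((‖p‖ ^ 2 / 2 : ℝ) : ℂ) by push_cast; rfl,
      ofReal_re, Complex.sq_norm, Complex.sq_norm, Complex.sq_norm, normSq_add, mul_comm z]
    ring
  rw [norm_fockWeighted, norm_fockWeighted, h, norm_neg, norm_mul, norm_exp, ← hre, Real.exp_add]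
  ring

theorem norm_cexp_neg_two_pi_lt_one : ‖cexp (-(2 * π))‖ < 1 := by
  rw [norm_exp]
  simp [Real.pi_pos]

/-- The Weierstrass sigma function of the lattice `ℤ[i]` (up to a constant factor), written as a
theta function at the nome `e^{-2π}`. The quadratic exponent makes the modulus of
`fockWeighted squareSigma` doubly periodic. -/
noncomputable def squareSigma (z : ℂ) : ℂ :=
  qTheta (cexp (-(2 * π))) (cexp (2 * π * I * z)) * cexp (π / 2 * z ^ 2 - π * I * z)

theorem differentiable_squareSigma : Differentiable ℂ squareSigma := fun z ↦ by
  have htheta : DifferentiableAt ℂ (fun z ↦ qTheta (cexp (-(2 * π))) (cexp (2 * π * I * z))) z :=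
    (differentiableAt_qTheta norm_cexp_neg_two_pi_lt_one (exp_ne_zero _)).fun_comp'
      (f := fun z ↦ cexp (2 * π * I * z)) z (by fun_prop)
  unfold squareSigma
  fun_prop

theorem squareSigma_zero : squareSigma 0 = 0 := by
  simp [squareSigma, qTheta_eq_one_sub_mul norm_cexp_neg_two_pi_lt_one]

theorem deriv_squareSigma_zero_ne_zero : deriv squareSigma 0 ≠ 0 := by
  set q := cexp (-(2 * π))
  have hq : ‖q‖ < 1 := norm_cexp_neg_two_pi_lt_one
  have hexp : HasDerivAt (fun z ↦ cexp (2 * π * I * z)) (2 * π * I) 0 := by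
    simpa using (hasDerivAt_const_mul (2 * π * I : ℂ) (x := 0)).cexp
  have htheta : HasDerivAt (fun z ↦ qTheta q (cexp (2 * π * I * z)))
      (-qProd q q ^ 2 * (2 * π * I)) 0 :=
    HasDerivAt.comp (h₂ := qTheta q) 0 (by simpa using hasDerivAt_qTheta_one hq) hexp
  have hsigma := htheta.fun_mul (d := fun z : ℂ ↦ cexp (π / 2 * z ^ 2 - π * I * z))
    (DifferentiableAt.hasDerivAt (by fun_prop))
  have hone : qTheta q 1 = 0 := by rw [qTheta_eq_one_sub_mul hq, sub_self, zero_mul]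
  change deriv (fun z ↦ qTheta q (cexp (2 * π * I * z)) * cexp (π / 2 * z ^ 2 - π * I * z)) 0 ≠ 0
  rw [hsigma.deriv]
  simp [hone, qProd_self_ne_zero hq, Real.pi_ne_zero]

theorem squareSigma_add_one (z : ℂ) :
    squareSigma (z + 1) = -(cexp (π * (conj 1 * z + ‖(1 : ℂ)‖ ^ 2 / 2)) * squareSigma z) := by
  have hperiod : cexp (2 * π * I * (z + 1)) = cexp (2 * π * I * z) := by
    rw [mul_add, mul_one, exp_add, exp_two_pi_mul_I, mul_one]
  have hexponent : π / 2 * (z + 1) ^ 2 - π * I * (z + 1) =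
      (π * (conj 1 * z + ‖(1 : ℂ)‖ ^ 2 / 2) + (π / 2 * z ^ 2 - π * I * z)) - π * I := by
    rw [map_one, norm_one, ofReal_one]
    ring
  rw [squareSigma, squareSigma, hperiod, hexponent, exp_sub_pi_mul_I, exp_add]
  ring

theorem squareSigma_add_I (z : ℂ) :
    squareSigma (z + I) = -(cexp (π * (conj I * z + ‖I‖ ^ 2 / 2)) * squareSigma z) := by
  have hperiod : cexp (2 * π * I * (z + I)) = cexp (-(2 * π)) * cexp (2 * π * I * z) := by
    rw [← exp_add]
    congr 1
    linear_combination 2 * π * I_sq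
  have hexponent : -(2 * π * I * z) + (π / 2 * (z + I) ^ 2 - π * I * (z + I)) =
      π * (conj I * z + ‖I‖ ^ 2 / 2) + (π / 2 * z ^ 2 - π * I * z) := by
    rw [conj_I, norm_I, ofReal_one]
    linear_combination -(π / 2) * I_sq
  rw [squareSigma, squareSigma, hperiod,
    qTheta_mul_left norm_cexp_neg_two_pi_lt_one (exp_ne_zero _) (exp_ne_zero _), ← exp_neg]
  have hmul := congrArg cexp hexponent
  rw [exp_add, exp_add (π * _)] at hmul
  linear_combination -qTheta (cexp (-(2 * π))) (cexp (2 * π * I * z)) * hmul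

theorem norm_fockWeighted_squareSigma_add (z : ℂ) (p : GaussianInt) :
    ‖fockWeighted squareSigma (z + p)‖ = ‖fockWeighted squareSigma z‖ := by
  have hone : Function.Periodic (fun z ↦ ‖fockWeighted squareSigma z‖) 1 :=
    fun z ↦ norm_fockWeighted_add (squareSigma_add_one z)
  have hI : Function.Periodic (fun z ↦ ‖fockWeighted squareSigma z‖) I :=
    fun z ↦ norm_fockWeighted_add (squareSigma_add_I z)
  simpa [GaussianInt.toComplex_def] using ((hone.int_mul p.re).add_period (hI.int_mul p.im)) z

theorem norm_eq_norm_fockWeighted_mul (F : ℂ → ℂ) (z : ℂ) :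
    ‖F z‖ = ‖fockWeighted F z‖ * Real.exp (π / 2 * ‖z‖ ^ 2) := by
  rw [norm_fockWeighted, mul_assoc, ← Real.exp_add, neg_add_cancel, Real.exp_zero, mul_one]

theorem squareSigma_toComplex (p : GaussianInt) : squareSigma p = 0 := by
  have h := norm_fockWeighted_squareSigma_add 0 p
  rw [zero_add] at h
  rw [← norm_eq_zero, norm_eq_norm_fockWeighted_mul, h, norm_fockWeighted, squareSigma_zero,
    norm_zero, zero_mul, zero_mul]

theorem exists_eq_toComplex_of_squareSigma_eq_zero {z : ℂ} (h : squareSigma z = 0) :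
    ∃ p : GaussianInt, z = p := by
  obtain ⟨k, hk⟩ := exists_eq_zpow_of_qTheta_eq_zero norm_cexp_neg_two_pi_lt_one
    ((mul_eq_zero.1 h).resolve_right (exp_ne_zero _))
  rw [← exp_int_mul, exp_eq_exp_iff_exists_int] at hk
  obtain ⟨m, hm⟩ := hk
  refine ⟨⟨m, k⟩, mul_left_cancel₀ two_pi_I_ne_zero ?_⟩
  rw [GaussianInt.toComplex_def']
  linear_combination hm - 2 * π * k * I_sq

-- Dividing two functions that vanish at `x` and `y` by the increment turns the relation between
-- their moduli into one between the moduli of their derivatives.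
theorem norm_deriv_eq_of_norm_add_eq {f g : ℂ → ℂ} {c : ℂ → ℝ} {x y : ℂ}
    (hf : DifferentiableAt ℂ f x) (hg : DifferentiableAt ℂ g y) (hc : ContinuousAt c 0)
    (hfx : f x = 0) (hgy : g y = 0) (h : ∀ t, ‖f (x + t)‖ = c t * ‖g (y + t)‖) :
    ‖deriv f x‖ = c 0 * ‖deriv g y‖ := by
  have hf' := (hasDerivAt_iff_tendsto_slope_zero.1 hf.hasDerivAt).norm
  have hg' := (hasDerivAt_iff_tendsto_slope_zero.1 hg.hasDerivAt).norm
  have hc' : Filter.Tendsto c (nhdsWithin 0 {0}ᶜ) (nhds (c 0)) := hc.mono_left nhdsWithin_le_nhds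
  refine tendsto_nhds_unique hf' ((hc'.mul hg').congr fun t ↦ ?_)
  rw [hfx, hgy, sub_zero, sub_zero, norm_smul, norm_smul, h, mul_left_comm]

theorem norm_deriv_squareSigma_toComplex (p : GaussianInt) :
    ‖deriv squareSigma p‖ = Real.exp (π / 2 * ‖(p : ℂ)‖ ^ 2) * ‖deriv squareSigma 0‖ := by
  convert norm_deriv_eq_of_norm_add_eq
    (c := fun t ↦ Real.exp (π / 2 * (‖p + t‖ ^ 2 - ‖t‖ ^ 2)))
    (differentiable_squareSigma p) (differentiable_squareSigma 0) (by fun_prop)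
    (squareSigma_toComplex p) squareSigma_zero fun t ↦ ?_ using 2
  · simp
  · rw [zero_add, norm_eq_norm_fockWeighted_mul squareSigma (p + t),
      norm_eq_norm_fockWeighted_mul squareSigma t, add_comm (p : ℂ),
      norm_fockWeighted_squareSigma_add, mul_left_comm, ← Real.exp_add]
    ring_nf

theorem deriv_squareSigma_toComplex_ne_zero (p : GaussianInt) : deriv squareSigma p ≠ 0 := by
  rw [← norm_pos_iff, norm_deriv_squareSigma_toComplex]
  exact mul_pos (Real.exp_pos _) (norm_pos_iff.2 deriv_squareSigma_zero_ne_zero)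

end SquareSigma

section OpenSquare

open Complex Set

/-- The open square of half side `r` centred at the origin. -/
def openSquare (r : ℝ) : Set ℂ := Ioo (-r) r ×ℂ Ioo (-r) r

variable {r : ℝ} {z : ℂ}

theorem isOpen_openSquare : IsOpen (openSquare r) := isOpen_Ioo.reProdIm isOpen_Ioo

theorem isBounded_openSquare : Bornology.IsBounded (openSquare r) :=
  (Metric.isBounded_Ioo _ _).reProdIm (Metric.isBounded_Ioo _ _)

theorem mem_openSquare : z ∈ openSquare r ↔ |z.re| < r ∧ |z.im| < r := by
  rw [openSquare, mem_reProdIm, mem_Ioo, mem_Ioo, abs_lt, abs_lt]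

theorem mem_openSquare_of_norm_lt (hz : ‖z‖ < r) : z ∈ openSquare r :=
  mem_openSquare.2 ⟨(abs_re_le_norm z).trans_lt hz, (abs_im_le_norm z).trans_lt hz⟩

theorem mem_closure_openSquare (hr : 0 < r) :
    z ∈ closure (openSquare r) ↔ |z.re| ≤ r ∧ |z.im| ≤ r := by
  rw [openSquare, closure_reProdIm, closure_Ioo (by linarith), mem_reProdIm, mem_Icc, mem_Icc,
    abs_le, abs_le]

theorem abs_eq_of_mem_frontier_openSquare (hr : 0 < r) (hz : z ∈ frontier (openSquare r)) :
    |z.re| = r ∨ |z.im| = r := by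
  have hclosure := (mem_closure_openSquare hr).1 hz.1
  rw [isOpen_openSquare.frontier_eq, mem_sdiff, mem_openSquare] at hz
  by_contra! hne
  exact hz.2 ⟨hclosure.1.lt_of_ne hne.1, hclosure.2.lt_of_ne hne.2⟩

theorem le_norm_of_mem_frontier_openSquare (hr : 0 < r) (hz : z ∈ frontier (openSquare r)) :
    r ≤ ‖z‖ := by
  rcases abs_eq_of_mem_frontier_openSquare hr hz with h | h
  · exact h ▸ abs_re_le_norm z
  · exact h ▸ abs_im_le_norm z

theorem injective_re_im : Function.Injective fun p : GaussianInt ↦ (p.re, p.im) :=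
  fun _ _ h ↦ Zsqrtd.ext (congrArg Prod.fst h) (congrArg Prod.snd h)

theorem finite_setOf_toComplex_mem_openSquare (r : ℝ) :
    {p : GaussianInt | (p : ℂ) ∈ openSquare r}.Finite := by
  refine Finite.subset (((finite_Icc (-⌈r⌉) ⌈r⌉).prod (finite_Icc (-⌈r⌉) ⌈r⌉)).preimage
    injective_re_im.injOn) fun p hp ↦ ?_
  have hle {m : ℤ} (hm : |(m : ℝ)| < r) : m ∈ Icc (-⌈r⌉) ⌈r⌉ := by
    rw [mem_Icc, ← abs_le]
    exact_mod_cast hm.le.trans (Int.le_ceil r)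
  rw [mem_ofPred_eq, mem_openSquare, ← GaussianInt.intCast_re, ← GaussianInt.intCast_im] at hp
  exact ⟨hle hp.1, hle hp.2⟩

theorem exists_sub_toComplex_mem_closure_openSquare (z : ℂ) :
    ∃ p : GaussianInt, z - p ∈ closure (openSquare (1 / 2)) := by
  refine ⟨⟨round z.re, round z.im⟩, (mem_closure_openSquare one_half_pos).2 ?_⟩
  rw [sub_re, sub_im, GaussianInt.re_toComplex, GaussianInt.im_toComplex]
  exact ⟨abs_sub_round _, abs_sub_round _⟩

/-- The points at distance at least `1/2` from every Gaussian integer, where `squareSigma` is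
comparable to `e^{(π/2)|z|²}`. -/
def farFromGaussianInt : Set ℂ := {z | ∀ p : GaussianInt, 1 / 2 ≤ ‖z - p‖}

theorem isClosed_farFromGaussianInt : IsClosed farFromGaussianInt := by
  simp only [farFromGaussianInt, ofPred_forall]
  exact isClosed_iInter fun p ↦ isClosed_le continuous_const (by fun_prop)

theorem sub_toComplex_mem_farFromGaussianInt (hz : z ∈ farFromGaussianInt) (p : GaussianInt) :
    z - p ∈ farFromGaussianInt := fun p' ↦ by
  rw [sub_sub, ← GaussianInt.toComplex_add]
  exact hz _

theorem half_le_abs_sub_intCast {x : ℝ} {n : ℕ} (hx : |x| = n + 1 / 2) (m : ℤ) :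
    1 / 2 ≤ |x - m| := by
  have half_le (k : ℤ) : (1 / 2 : ℝ) ≤ |(k : ℝ) + 1 / 2| := by
    rw [le_abs]
    rcases lt_or_ge k 0 with hk | hk
    · have : (k : ℝ) ≤ -1 := by exact_mod_cast Int.le_sub_one_of_lt hk
      right; linarith
    · have : (0 : ℝ) ≤ k := by exact_mod_cast hk
      left; linarith
  rcases (abs_eq (by positivity)).1 hx with rfl | rfl
  · convert half_le (n - m) using 2
    push_cast
    ring
  · convert half_le (-n - 1 - m) using 2
    push_cast
    ring

theorem frontier_openSquare_subset_farFromGaussianInt (n : ℕ) :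
    frontier (openSquare (n + 1 / 2)) ⊆ farFromGaussianInt := fun z hz p ↦ by
  rcases abs_eq_of_mem_frontier_openSquare (by positivity) hz with h | h
  · refine (half_le_abs_sub_intCast h p.re).trans ?_
    rw [GaussianInt.intCast_re, ← sub_re]
    exact abs_re_le_norm _
  · refine (half_le_abs_sub_intCast h p.im).trans ?_
    rw [GaussianInt.intCast_im, ← sub_im]
    exact abs_im_le_norm _

end OpenSquare

section SquareSigmaEstimates

open Complex Set
open scoped Real

theorem squareSigma_ne_zero_of_mem_farFromGaussianInt {z : ℂ} (hz : z ∈ farFromGaussianInt) :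
    squareSigma z ≠ 0 := fun h ↦ by
  obtain ⟨p, rfl⟩ := exists_eq_toComplex_of_squareSigma_eq_zero h
  have hdist := hz p
  rw [sub_self, norm_zero] at hdist
  norm_num at hdist

theorem exists_pos_le_norm_fockWeighted_squareSigma :
    ∃ c > 0, ∀ z ∈ farFromGaussianInt, c ≤ ‖fockWeighted squareSigma z‖ := by
  have hcompact : IsCompact (closure (openSquare (1 / 2)) ∩ farFromGaussianInt) :=
    isBounded_openSquare.isCompact_closure.inter_right isClosed_farFromGaussianInt
  obtain ⟨c, hc, hle⟩ := hcompact.exists_forall_le'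
    (continuous_fockWeighted differentiable_squareSigma.continuous).norm.continuousOn (a := 0)
    fun z hz ↦ by
      rw [norm_fockWeighted]
      have := norm_pos_iff.2 (squareSigma_ne_zero_of_mem_farFromGaussianInt hz.2)
      positivity
  refine ⟨c, hc, fun z hz ↦ ?_⟩
  obtain ⟨p, hp⟩ := exists_sub_toComplex_mem_closure_openSquare z
  rw [← sub_add_cancel z (p : ℂ), norm_fockWeighted_squareSigma_add]
  exact hle _ ⟨hp, sub_toComplex_mem_farFromGaussianInt hz p⟩

theorem exp_isBigO_squareSigma :
    (fun z ↦ Real.exp (π / 2 * ‖z‖ ^ 2)) =O[Filter.principal farFromGaussianInt] squareSigma := by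
  obtain ⟨c, hc, hle⟩ := exists_pos_le_norm_fockWeighted_squareSigma
  refine Asymptotics.isBigO_principal.2 ⟨c⁻¹, fun z hz ↦ ?_⟩
  rw [Real.norm_of_nonneg (Real.exp_nonneg _), norm_eq_norm_fockWeighted_mul, ← mul_assoc]
  exact le_mul_of_one_le_left (Real.exp_nonneg _) ((one_le_inv_mul₀ hc).2 (hle z hz))

theorem summable_exp_neg_pi_div_two_mul_sq :
    Summable fun m : ℤ ↦ Real.exp (-(π / 2 * (m : ℝ) ^ 2)) := by
  refine ((summable_jacobiTheta₂_term_iff 0 (I / 2)).2 (by simp)).norm.congr fun m ↦ ?_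
  have hexponent : 2 * π * I * m * 0 + π * I * (m : ℂ) ^ 2 * (I / 2) =
      ((-(π / 2 * (m : ℝ) ^ 2) : ℝ) : ℂ) := by
    push_cast
    linear_combination (π / 2 * (m : ℂ) ^ 2) * I_sq
  rw [jacobiTheta₂_term, hexponent, norm_exp_ofReal]

theorem summable_inv_norm_deriv_squareSigma :
    Summable fun p : GaussianInt ↦ ‖deriv squareSigma p‖⁻¹ := by
  have hsum := summable_exp_neg_pi_div_two_mul_sq.mul_of_nonneg
    summable_exp_neg_pi_div_two_mul_sq (fun _ ↦ Real.exp_nonneg _) fun _ ↦ Real.exp_nonneg _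
  refine ((hsum.comp_injective injective_re_im).mul_right ‖deriv squareSigma 0‖⁻¹).congr fun p ↦ ?_
  have hsq : ‖(p : ℂ)‖ ^ 2 = (p.re : ℝ) ^ 2 + (p.im : ℝ) ^ 2 := by
    rw [Complex.sq_norm, normSq_apply, GaussianInt.intCast_re, GaussianInt.intCast_im, sq, sq]
  rw [norm_deriv_squareSigma_toComplex, mul_inv, ← Real.exp_neg, hsq, mul_add, neg_add,
    Real.exp_add, Function.comp_apply]

end SquareSigmaEstimates

section RemovableQuotient

open Complex Filter Set
open scoped Topology

variable {E : Type*} [NormedAddCommGroup E] [NormedSpace ℂ E] [CompleteSpace E]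
  {G : ℂ → E} {S : ℂ → ℂ}

open Classical in
/-- The quotient `G / S` with its singularities removed, provided that the zeros of `S` are simple
and are zeros of `G`. -/
noncomputable def removableQuotient (G : ℂ → E) (S : ℂ → ℂ) (z : ℂ) : E :=
  if S z = 0 then (deriv S z)⁻¹ • deriv G z else (S z)⁻¹ • G z

theorem differentiableAt_removableQuotient {U : Set ℂ} {z : ℂ} (hU : U ∈ 𝓝 z)
    (hG : DifferentiableOn ℂ G U) (hS : DifferentiableOn ℂ S U)
    (hz : S z = 0 → G z = 0 ∧ deriv S z ≠ 0) :
    DifferentiableAt ℂ (removableQuotient G S) z := by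
  by_cases h : S z = 0
  · obtain ⟨hGz, hSz⟩ := hz h
    have hdG : DifferentiableAt ℂ (dslope G z) z :=
      ((differentiableOn_dslope hU).2 hG).differentiableAt hU
    have hdS : DifferentiableAt ℂ (dslope S z) z :=
      ((differentiableOn_dslope hU).2 hS).differentiableAt hU
    rw [← dslope_same] at hSz
    refine ((hdS.inv hSz).smul hdG).congr_of_eventuallyEq ?_
    filter_upwards [hdS.continuousAt.eventually_ne hSz] with w hw
    rw [Pi.smul_apply', Pi.inv_apply]
    rcases eq_or_ne w z with rfl | hne
    · rw [removableQuotient, if_pos h, dslope_same, dslope_same]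
    · have hSw : S w = (w - z) * dslope S z w := (sub_smul_dslope_of_zero h w).symm
      have hGw : G w = (w - z) • dslope G z w := (sub_smul_dslope_of_zero hGz w).symm
      have hne' : w - z ≠ 0 := sub_ne_zero.2 hne
      rw [removableQuotient, hSw, hGw, if_neg (mul_ne_zero hne' hw), smul_smul, mul_inv,
        mul_right_comm, inv_mul_cancel₀ hne', one_mul]
  · refine (((hS.differentiableAt hU).inv h).smul (hG.differentiableAt hU)).congr_of_eventuallyEq ?_
    filter_upwards [(hS.differentiableAt hU).continuousAt.eventually_ne h] with w hw
    exact if_neg hw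

theorem diffContOnCl_removableQuotient {U : Set ℂ} (hU : IsOpen U) (hG : DiffContOnCl ℂ G U)
    (hS : DiffContOnCl ℂ S U) (hzero : ∀ z ∈ U, S z = 0 → G z = 0 ∧ deriv S z ≠ 0)
    (hfrontier : ∀ z ∈ frontier U, S z ≠ 0) : DiffContOnCl ℂ (removableQuotient G S) U := by
  have hdiff (z) (hz : z ∈ U) : DifferentiableAt ℂ (removableQuotient G S) z :=
    differentiableAt_removableQuotient (hU.mem_nhds hz) hG.differentiableOn hS.differentiableOn
      (hzero z hz)
  refine ⟨fun z hz ↦ (hdiff z hz).differentiableWithinAt, fun z hz ↦ ?_⟩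
  by_cases hzU : z ∈ U
  · exact (hdiff z hzU).continuousAt.continuousWithinAt
  · have hSz : S z ≠ 0 := hfrontier z (hU.frontier_eq ▸ ⟨hz, hzU⟩)
    refine (((hS.continuousOn z hz).inv₀ hSz).smul (hG.continuousOn z hz)).congr_of_eventuallyEq
      ?_ (if_neg hSz)
    filter_upwards [(hS.continuousOn z hz).eventually_ne hSz] with w hw
    exact if_neg hw

theorem norm_le_mul_norm_of_frontier {U : Set ℂ} (hU : IsOpen U) (hbounded : Bornology.IsBounded U)
    (hG : DiffContOnCl ℂ G U) (hS : DiffContOnCl ℂ S U)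
    (hzero : ∀ z ∈ U, S z = 0 → G z = 0 ∧ deriv S z ≠ 0) (hfrontier : ∀ z ∈ frontier U, S z ≠ 0)
    {C : ℝ} (hle : ∀ z ∈ frontier U, ‖G z‖ ≤ C * ‖S z‖) {z : ℂ} (hz : z ∈ U) :
    ‖G z‖ ≤ C * ‖S z‖ := by
  have norm_eq {w : ℂ} (hw : S w ≠ 0) : ‖removableQuotient G S w‖ = ‖G w‖ / ‖S w‖ := by
    rw [removableQuotient, if_neg hw, norm_smul, norm_inv, inv_mul_eq_div]
  by_cases hSz : S z = 0
  · rw [(hzero z hz hSz).1, hSz, norm_zero, norm_zero, mul_zero]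
  rw [← div_le_iff₀ (norm_pos_iff.2 hSz), ← norm_eq hSz]
  refine norm_le_of_forall_mem_frontier_norm_le hbounded
    (diffContOnCl_removableQuotient hU hG hS hzero hfrontier) (fun w hw ↦ ?_) (subset_closure hz)
  rw [norm_eq (hfrontier w hw), div_le_iff₀ (norm_pos_iff.2 (hfrontier w hw))]
  exact hle w hw

end RemovableQuotient

section EntireLagrange

open Complex Filter

variable {E : Type*} [NormedAddCommGroup E] [NormedSpace ℂ E]
  {S : ℂ → ℂ} {ι : Type*} {s : Finset ι} {v : ι → ℂ} {r : ι → E}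

/-- The Lagrange interpolant of the values `r i` at the nodes `v i`, built from an entire function
`S` in place of the nodal polynomial. -/
noncomputable def entireLagrange (S : ℂ → ℂ) (s : Finset ι) (v : ι → ℂ) (r : ι → E) (z : ℂ) : E :=
  ∑ i ∈ s, (dslope S (v i) z / deriv S (v i)) • r i

theorem differentiable_entireLagrange (hS : Differentiable ℂ S) :
    Differentiable ℂ (entireLagrange S s v r) := by
  have hdslope (c : ℂ) : Differentiable ℂ (dslope S c) :=
    differentiableOn_univ.1 ((differentiableOn_dslope univ_mem).2 hS.differentiableOn)
  exact Differentiable.fun_sum fun i _ ↦ ((hdslope (v i)).div_const _).smul_const (r i)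

theorem entireLagrange_apply_node (hv : Set.InjOn v s) (hS : ∀ i ∈ s, S (v i) = 0) {j : ι}
    (hj : j ∈ s) (hderiv : deriv S (v j) ≠ 0) : entireLagrange S s v r (v j) = r j := by
  rw [entireLagrange, Finset.sum_eq_single_of_mem j hj, dslope_same, div_self hderiv, one_smul]
  intro i hi hij
  rw [dslope_of_ne _ (hv.ne hj hi hij.symm), slope_def_field, hS i hi, hS j hj, sub_zero, zero_div,
    zero_div, zero_smul]

theorem norm_entireLagrange_le {δ M : ℝ} (hδ : 0 < δ) (hS : ∀ i ∈ s, S (v i) = 0)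
    (hr : ∀ i ∈ s, ‖r i‖ ≤ M) {z : ℂ} (hz : ∀ i ∈ s, δ ≤ ‖z - v i‖) :
    ‖entireLagrange S s v r z‖ ≤ M / δ * (∑ i ∈ s, ‖deriv S (v i)‖⁻¹) * ‖S z‖ := by
  rw [Finset.mul_sum, Finset.sum_mul]
  refine norm_sum_le_of_le s fun i hi ↦ ?_
  have hpos : 0 < ‖z - v i‖ := hδ.trans_le (hz i hi)
  rw [dslope_of_ne _ (sub_ne_zero.1 (norm_pos_iff.1 hpos)), slope_def_field, hS i hi, sub_zero,
    norm_smul, norm_div, norm_div]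
  calc ‖S z‖ / ‖z - v i‖ / ‖deriv S (v i)‖ * ‖r i‖
      ≤ ‖S z‖ / δ / ‖deriv S (v i)‖ * M := by gcongr; exacts [hz i hi, hr i hi]
    _ = M / δ * ‖deriv S (v i)‖⁻¹ * ‖S z‖ := by ring

end EntireLagrange

section Uniqueness

open Asymptotics Bornology Complex Filter Set
open scoped Real

theorem isLittleO_exp_mul_norm_add_sq {V : Type*} [NormedAddCommGroup V] {b c : ℝ} (hbc : b < c)
    (p : V) : (fun z ↦ Real.exp (b * ‖z + p‖ ^ 2)) =o[cobounded V]
      fun z ↦ Real.exp (c * ‖z‖ ^ 2) := by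
  rw [Real.isLittleO_exp_comp_exp_comp]
  have hquadratic : Tendsto (fun t : ℝ ↦ t * ((c - b) * t + -(2 * |b| * ‖p‖)) + -(|b| * ‖p‖ ^ 2))
      atTop atTop :=
    tendsto_atTop_add_const_right _ _ (tendsto_id.atTop_mul_atTop₀
      (tendsto_atTop_add_const_right _ _ (tendsto_id.const_mul_atTop (sub_pos.2 hbc))))
  refine tendsto_atTop_mono (fun z ↦ ?_) (hquadratic.comp tendsto_norm_cobounded_atTop)
  have hdiff : |‖z + p‖ - ‖z‖| ≤ ‖p‖ := by simpa using abs_norm_sub_norm_le (z + p) z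
  have hsum : ‖z + p‖ + ‖z‖ ≤ 2 * ‖z‖ + ‖p‖ := by linarith [norm_add_le z p]
  have hsq : b * (‖z + p‖ ^ 2 - ‖z‖ ^ 2) ≤ |b| * (‖p‖ * (2 * ‖z‖ + ‖p‖)) := by
    calc b * (‖z + p‖ ^ 2 - ‖z‖ ^ 2)
        ≤ |b * (‖z + p‖ ^ 2 - ‖z‖ ^ 2)| := le_abs_self _
      _ = |b| * (|‖z + p‖ - ‖z‖| * (‖z + p‖ + ‖z‖)) := by
          rw [abs_mul, sq_sub_sq, abs_mul, abs_of_nonneg (by positivity : 0 ≤ ‖z + p‖ + ‖z‖),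
            mul_comm (‖z + p‖ + ‖z‖)]
      _ ≤ |b| * (‖p‖ * (2 * ‖z‖ + ‖p‖)) := by gcongr
  rw [Function.comp_apply]
  linarith

variable {E : Type*} [NormedAddCommGroup E] [NormedSpace ℂ E] {F : ℂ → E} {M : ℝ}

theorem exists_interpolant_norm_le_squareSigma (hM : ∀ p : GaussianInt, ‖F p‖ ≤ M) (r : ℝ) :
    ∃ L : ℂ → E, Differentiable ℂ L ∧ (∀ p : GaussianInt, (p : ℂ) ∈ openSquare r → L p = F p) ∧
      ∀ z ∈ farFromGaussianInt,
        ‖L z‖ ≤ 2 * M * (∑' p : GaussianInt, ‖deriv squareSigma p‖⁻¹) * ‖squareSigma z‖ := by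
  have hM0 : 0 ≤ M := (norm_nonneg _).trans (hM 0)
  set s := (finite_setOf_toComplex_mem_openSquare r).toFinset
  refine ⟨entireLagrange squareSigma s GaussianInt.toComplex fun p ↦ F p,
    differentiable_entireLagrange differentiable_squareSigma, fun p hp ↦ ?_, fun z hz ↦ ?_⟩
  · exact entireLagrange_apply_node GaussianInt.toComplex_injective.injOn
      (fun q _ ↦ squareSigma_toComplex q) ((Finite.mem_toFinset _).2 hp)
      (deriv_squareSigma_toComplex_ne_zero p)
  · calc ‖entireLagrange squareSigma s GaussianInt.toComplex (fun p ↦ F p) z‖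
        ≤ M / (1 / 2) * (∑ p ∈ s, ‖deriv squareSigma p‖⁻¹) * ‖squareSigma z‖ :=
          norm_entireLagrange_le one_half_pos (fun q _ ↦ squareSigma_toComplex q)
            (fun q _ ↦ hM q) fun q _ ↦ hz q
      _ ≤ 2 * M * (∑' p : GaussianInt, ‖deriv squareSigma p‖⁻¹) * ‖squareSigma z‖ := by
          rw [div_div_eq_mul_div, div_one, mul_comm M 2]
          gcongr
          exact summable_inv_norm_deriv_squareSigma.sum_le_tsum _ fun _ _ ↦ by positivity

variable [CompleteSpace E]

theorem norm_le_mul_norm_squareSigma (hF : Differentiable ℂ F)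
    (hgrowth : F =o[cobounded ℂ] fun z ↦ Real.exp (π / 2 * ‖z‖ ^ 2))
    (hM : ∀ p : GaussianInt, ‖F p‖ ≤ M) {z : ℂ} (hz : z ∈ farFromGaussianInt) :
    ‖F z‖ ≤ (4 * M * (∑' p : GaussianInt, ‖deriv squareSigma p‖⁻¹) + 1) * ‖squareSigma z‖ := by
  have hsmall : F =o[cobounded ℂ ⊓ 𝓟 farFromGaussianInt] squareSigma :=
    (hgrowth.mono inf_le_left).trans_isBigO (exp_isBigO_squareSigma.mono inf_le_right)
  obtain ⟨R, hR⟩ : ∃ R, ∀ w, R ≤ ‖w‖ → w ∈ farFromGaussianInt → ‖F w‖ ≤ 1 * ‖squareSigma w‖ := by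
    simpa using hasBasis_cobounded_norm.eventually_iff.1
      (eventually_inf_principal.1 (hsmall.def one_pos))
  obtain ⟨n, hn⟩ := exists_nat_ge (max R ‖z‖)
  have hn' : max R ‖z‖ < n + 1 / 2 := by linarith
  obtain ⟨L, hL, hinterp, hLle⟩ := exists_interpolant_norm_le_squareSigma hM (n + 1 / 2)
  set B := 2 * M * ∑' p : GaussianInt, ‖deriv squareSigma p‖⁻¹
  have herror : ‖(F - L) z‖ ≤ (1 + B) * ‖squareSigma z‖ := by
    refine norm_le_mul_norm_of_frontier isOpen_openSquare isBounded_openSquare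
      (hF.sub hL).diffContOnCl differentiable_squareSigma.diffContOnCl (fun w hw hw0 ↦ ?_)
      (fun w hw ↦ squareSigma_ne_zero_of_mem_farFromGaussianInt
        (frontier_openSquare_subset_farFromGaussianInt n hw)) (fun w hw ↦ ?_)
      (mem_openSquare_of_norm_lt ((le_max_right _ _).trans_lt hn'))
    · obtain ⟨p, rfl⟩ := exists_eq_toComplex_of_squareSigma_eq_zero hw0
      exact ⟨sub_eq_zero.2 (hinterp p hw).symm, deriv_squareSigma_toComplex_ne_zero p⟩
    · have hfar := frontier_openSquare_subset_farFromGaussianInt n hw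
      have hRw : R ≤ ‖w‖ := ((le_max_left _ _).trans hn'.le).trans
        (le_norm_of_mem_frontier_openSquare (by positivity) hw)
      rw [add_mul]
      exact (norm_sub_le _ _).trans (add_le_add (hR w hRw hfar) (hLle w hfar))
  calc ‖F z‖ = ‖(F - L) z + L z‖ := by rw [Pi.sub_apply, sub_add_cancel]
    _ ≤ (1 + B) * ‖squareSigma z‖ + B * ‖squareSigma z‖ :=
        (norm_add_le _ _).trans (add_le_add herror (hLle z hz))
    _ = _ := by ring

theorem eq_of_isBigO_exp_of_bounded_on_gaussianInt (hF : Differentiable ℂ F) {b : ℝ}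
    (hb : b < π / 2) (hgrowth : F =O[cobounded ℂ] fun z ↦ Real.exp (b * ‖z‖ ^ 2))
    (hM : ∀ p : GaussianInt, ‖F p‖ ≤ M) (z w : ℂ) : F z = F w := by
  have hcompact : IsCompact (closure (openSquare (1 / 2))) :=
    isBounded_openSquare.isCompact_closure
  obtain ⟨K, hK⟩ := hcompact.exists_bound_of_continuousOn
    differentiable_squareSigma.continuous.continuousOn
  have hM0 : 0 ≤ M := (norm_nonneg _).trans (hM 0)
  set C := 4 * M * (∑' p : GaussianInt, ‖deriv squareSigma p‖⁻¹) + 1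
  have hle (u : ℂ) : ‖F u‖ ≤ C * K := by
    obtain ⟨p, hp⟩ := exists_sub_toComplex_mem_closure_openSquare u
    have hshift : Differentiable ℂ fun v ↦ F (v + p) := by fun_prop
    have hgrowth' : (fun v ↦ F (v + p)) =o[cobounded ℂ] fun v ↦ Real.exp (π / 2 * ‖v‖ ^ 2) :=
      (hgrowth.comp_tendsto (tendsto_add_const_cobounded _)).trans_isLittleO
        (isLittleO_exp_mul_norm_add_sq hb (p : ℂ))
    suffices h : ‖F (u - p + p)‖ ≤ C * K by rwa [sub_add_cancel] at h
    refine norm_le_of_forall_mem_frontier_norm_le isBounded_openSquare hshift.diffContOnCl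
      (fun v hv ↦ ?_) hp
    have hM' (q : GaussianInt) : ‖F (q + p)‖ ≤ M := by
      rw [← GaussianInt.toComplex_add]
      exact hM _
    have hfar : v ∈ farFromGaussianInt :=
      frontier_openSquare_subset_farFromGaussianInt 0 (by simpa using hv)
    exact (norm_le_mul_norm_squareSigma hshift hgrowth' hM' hfar).trans
      (mul_le_mul_of_nonneg_left (hK v (frontier_subset_closure hv)) (by positivity))
  exact hF.apply_eq_apply_of_bounded
    (isBounded_iff_forall_norm_le.2 ⟨C * K, by rintro _ ⟨u, rfl⟩; exact hle u⟩) z w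

end Uniqueness

section PhaseRetrieval

open Asymptotics Complex
open scoped Real

variable {a : ℝ}

theorem apply_eq_apply_of_bounded_on_complexSquareLattice (ha0 : 0 < a) (ha1 : a < 1) {F : ℂ → ℂ}
    (hF : F ∈ fockSpace) {M : ℝ} (hM : ∀ z ∈ complexSquareLattice a, ‖F z‖ ≤ M) (z w : ℂ) :
    F z = F w := by
  have ha : (a : ℂ) ≠ 0 := ofReal_ne_zero.2 ha0.ne'
  obtain ⟨f, rfl⟩ := exists_bargmann_eq hF
  have hdiff : Differentiable ℂ fun u ↦ bargmann f (a * u) := by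
    have := differentiable_bargmann f
    fun_prop
  have hgrowth (u : ℂ) : ‖bargmann f (a * u)‖ ≤ ‖f‖ * Real.exp (π / 2 * a ^ 2 * ‖u‖ ^ 2) := by
    refine (norm_bargmann_le f (a * u)).trans_eq ?_
    rw [norm_mul, norm_real, mul_pow, Real.norm_eq_abs, sq_abs, mul_assoc]
  have hb : π / 2 * a ^ 2 < π / 2 :=
    mul_lt_of_lt_one_right (by positivity) (pow_lt_one₀ ha0.le ha1 two_ne_zero)
  have hlattice (p : GaussianInt) : ‖bargmann f (a * p)‖ ≤ M :=
    hM _ ⟨p.re, p.im, by rw [GaussianInt.toComplex_def]; ring⟩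
  simpa [mul_div_cancel₀ _ ha] using
    eq_of_isBigO_exp_of_bounded_on_gaussianInt hdiff hb
      (.of_bound ‖f‖ (.of_forall fun u ↦ by simpa using hgrowth u)) hlattice (z / a) (w / a)

theorem exists_phase_of_norm_eq_one (ha0 : 0 < a) (ha1 : a < 1) {F : ℂ → ℂ}
    (hF : F ∈ fockSpace) (h1 : ∀ z ∈ complexSquareLattice a, ‖F z‖ = 1) :
    ∃ α : ℝ, ∀ z : ℂ, F z = cexp (I * α) := by
  have hzero : ‖F 0‖ = 1 := h1 0 ⟨0, 0, by simp⟩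
  refine ⟨(F 0).arg, fun z ↦ ?_⟩
  calc F z = F 0 := apply_eq_apply_of_bounded_on_complexSquareLattice ha0 ha1 hF
        (fun z hz ↦ (h1 z hz).le) z 0
    _ = ‖F 0‖ * cexp ((F 0).arg * I) := (norm_mul_exp_arg_mul_I (F 0)).symm
    _ = cexp (I * (F 0).arg) := by rw [hzero, ofReal_one, one_mul, mul_comm]

theorem norm_gabor_sq_eq_norm_gabor_gaussian_sq_iff (f : L2R) (x ω : ℝ) :
    ‖gabor f (x, ω)‖ ^ 2 = ‖gabor gaussian (x, ω)‖ ^ 2 ↔ ‖bargmann f (x - ω * I)‖ = 1 := by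
  rw [sq_eq_sq₀ (norm_nonneg _) (norm_nonneg _), norm_gabor, norm_gabor, norm_fockWeighted,
    norm_fockWeighted, bargmann_gaussian, norm_one, mul_left_inj' (Real.exp_ne_zero _)]

theorem norm_gabor_sq_eq_on_squareLattice_iff (a : ℝ) (f : L2R) :
    (∀ p ∈ squareLattice a, ‖gabor f p‖ ^ 2 = ‖gabor gaussian p‖ ^ 2) ↔
      ∀ z ∈ complexSquareLattice a, ‖bargmann f z‖ = 1 := by
  have hpoint (m n : ℤ) : (a * m + I * (a * n) : ℂ) =
      (a * m : ℝ) - (a * (-n : ℤ) : ℝ) * I := by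
    push_cast
    ring
  constructor
  · rintro h _ ⟨m, n, rfl⟩
    rw [hpoint, ← norm_gabor_sq_eq_norm_gabor_gaussian_sq_iff]
    exact h _ ⟨m, -n, rfl⟩
  · rintro h _ ⟨m, n, rfl⟩
    rw [norm_gabor_sq_eq_norm_gabor_gaussian_sq_iff]
    simpa only [hpoint, neg_neg] using h _ ⟨m, -n, rfl⟩

theorem eq_exp_smul_gaussian_iff (f : L2R) (α : ℝ) :
    f = cexp (I * α) • gaussian ↔ ∀ z : ℂ, bargmann f z = cexp (I * α) := by
  rw [← bargmann_injective.eq_iff, funext_iff]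
  simp_rw [bargmann_smul, bargmann_gaussian, mul_one]

theorem exists_eq_exp_smul_gaussian (ha0 : 0 < a) (ha1 : a < 1) (f : L2R)
    (hf : ∀ p ∈ squareLattice a, ‖gabor f p‖ ^ 2 = ‖gabor gaussian p‖ ^ 2) :
    ∃ α : ℝ, f = cexp (I * α) • gaussian :=
  (exists_phase_of_norm_eq_one ha0 ha1 (bijOn_bargmann.mapsTo (Set.mem_univ f))
    ((norm_gabor_sq_eq_on_squareLattice_iff a f).1 hf)).imp
      fun α ↦ (eq_exp_smul_gaussian_iff f α).2

theorem AgreeUpToGlobalPhase.symm {f g : L2R} (h : AgreeUpToGlobalPhase f g) :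
    AgreeUpToGlobalPhase g f := by
  obtain ⟨α, rfl⟩ := h
  refine ⟨-α, ?_⟩
  rw [smul_smul, ← exp_add, ofReal_neg, mul_neg, neg_add_cancel, exp_zero, one_smul]

theorem gaussian_notMem_counterexamples (ha0 : 0 < a) (ha1 : a < 1) :
    gaussian ∉ counterexamples (squareLattice a) := by
  rintro ⟨g, hg, hne⟩
  have hphase : AgreeUpToGlobalPhase g gaussian :=
    exists_eq_exp_smul_gaussian ha0 ha1 g fun p hp ↦ by rw [hg p hp]
  exact hne hphase.symm

end PhaseRetrieval

theorem theorem3 (a : ℝ) (ha0 : 0 < a) (ha1 : a < 1) :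
    -- the Gaussian is determined up to global phase by its Gabor magnitudes on `aℤ²`
    (∀ f : L2R, (∀ p ∈ squareLattice a, ‖gabor f p‖ ^ 2 = ‖gabor gaussian p‖ ^ 2) →
      ∃ α : ℝ, f = Complex.exp (Complex.I * α) • gaussian) ∧
    -- hence it is not a counterexample, and not every signal is one
    gaussian ∉ counterexamples (squareLattice a) ∧
    counterexamples (squareLattice a) ≠ Set.univ ∧
    -- the restatement in Fock space
    (∀ F ∈ fockSpace, (∀ z ∈ complexSquareLattice a, ‖F z‖ = 1) →
      ∃ α : ℝ, ∀ z : ℂ, F z = Complex.exp (Complex.I * α)) ∧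
    -- the Bargmann transform carries the hypothesis and the conclusion of the first claim
    -- to those of the restatement, and is a bijection of `L²(ℝ)` onto Fock space
    Set.BijOn bargmann Set.univ fockSpace ∧
    (∀ f : L2R,
      ((∀ p ∈ squareLattice a, ‖gabor f p‖ ^ 2 = ‖gabor gaussian p‖ ^ 2) ↔
        ∀ z ∈ complexSquareLattice a, ‖bargmann f z‖ = 1) ∧
      ∀ α : ℝ, (f = Complex.exp (Complex.I * α) • gaussian ↔
        ∀ z : ℂ, bargmann f z = Complex.exp (Complex.I * α))) :=
  ⟨exists_eq_exp_smul_gaussian ha0 ha1,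
    gaussian_notMem_counterexamples ha0 ha1,
    fun h ↦ gaussian_notMem_counterexamples ha0 ha1 (h ▸ Set.mem_univ gaussian),
    fun _ ↦ exists_phase_of_norm_eq_one ha0 ha1,
    bijOn_bargmann,
    fun f ↦ ⟨norm_gabor_sq_eq_on_squareLattice_iff a f, eq_exp_smul_gaussian_iff f⟩⟩
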